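/- Let $\mathbf{k}$ be an algebraically closed field of characteristic $0$ and let $N\ge 0$, $r\ge 1$ be integers. The group $SL(N+1)$ acts on $(N+1)\times(N+1)$ skew-symmetric matrices by congruence, $A\mapsto gAg^t$, hence on vector spaces of such matrices. A space $M$ of matrices has constant rank $2r$ if every nonzero matrix in $M$ has rank $2r$. It is nondegenerate if the kernels of its matrices intersect in $0$ and their images together generate $\mathbf{k}^{N+1}$. For a partition $r=r_1+\dots+r_h$ with $r_1\ge\dots\ge r_h\ge 1$, let $U_s$ be the $s\times(s+1)$ matrix of linear forms in $a,b$ with $(i,i)$ entries $a$, $(i,i+1)$ entries $b$ and all other entries $0$, let $\overline F$ be the $r\times(r+h)$ block-diagonal matrix with diagonal blocks $U_{r_1},\dots,U_{r_h}$, and let $$F=\begin{pmatrix}0_r&\overline F\\-\overline F^{\,t}&0_{r+h}\end{pmatrix},$$ a matrix of order $2r+h$, identified with the space of its values for $(a,b)\in\mathbf{k}^2$. (1) A vector space $M$ of $(N+1)\times(N+1)$ matrices is a nondegenerate $2$-dimensional space of skew-symmetric matrices of constant rank $2r$ if and only if it is $SL(N+1)$-equivalent to the space of one of the matrices $F$,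 for some partition $r=r_1+\dots+r_h$ with $N=2r+h-1$. (2) If $M$ is such a space and $A,B$ is any basis of $M$, then for some partition $r=r_1+\dots+r_h$ with $N=2r+h-1$ the pencil $aA+bB$ is congruent to $F$ by an element of $SL(N+1)$ (independent of $a,b$), and it is strictly equivalent to $F$, that is, $P(aA+bB)Q=F$ for some invertible matrices $P,Q$ over $\mathbf{k}$ (independent of $a,b$). (3) A vector space $M$ of $(N+1)\times(N+1)$ matrices is a $2$-dimensional space of skew-symmetric matrices of constant rank $2r$ (possibly degenerate) if and only if it is $SL(N+1)$-equivalent to the space of one of the matrices $F$, for a partition $r=r_1+\dots+r_h$ with $2r+h\le N+1$, with $N+1-(2r+h)$ zero rows and columns added at the end. -/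

import Mathlib

namespace SkewPencil

open Matrix

/-- A partition `r = r₁ + ⋯ + r_h` with exactly `h` positive parts `r₁ ≥ ⋯ ≥ r_h`. -/
structure Parts (r h : ℕ) where
  part : Fin h → ℕ
  pos : ∀ i, 0 < part i
  anti : Antitone part
  sum_eq : ∑ i, part i = r

theorem Parts.sum_succ_eq {r h : ℕ} (p : Parts r h) : ∑ i, (p.part i + 1) = r + h := by
  simp [Finset.sum_add_distrib, p.sum_eq]

section Blocks

variable {k : Type*} [CommRing k]

/-- The `s × (s+1)` block `U_s` with rows `(a b 0 ⋯ 0), (0 a b 0 ⋯ 0), …, (0 ⋯ 0 a b)`. -/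
def U (s : ℕ) (a b : k) : Matrix (Fin s) (Fin (s + 1)) k :=
  Matrix.of fun i j => if j = i.castSucc then a else if j = i.succ then b else 0

/-- The `r × (r+h)` block-diagonal matrix with diagonal blocks `U_{r₁}, …, U_{r_h}`, in this
order. -/
def Fbar {r h : ℕ} (p : Parts r h) (a b : k) : Matrix (Fin r) (Fin (r + h)) k :=
  Matrix.reindex (finSigmaFinEquiv.trans (finCongr p.sum_eq))
    (finSigmaFinEquiv.trans (finCongr p.sum_succ_eq))
    (Matrix.blockDiagonal' fun i => U (p.part i) a b)

/-- The matrix of linear forms `F = [[0_r, Fbar], [-Fbarᵀ, 0_{r+h}]]`, of order `2r + h`, evaluated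
at `(a, b)`. -/
def F {r h : ℕ} (p : Parts r h) (a b : k) : Matrix (Fin (2 * r + h)) (Fin (2 * r + h)) k :=
  Matrix.reindex (finSumFinEquiv.trans (finCongr (by omega)))
    (finSumFinEquiv.trans (finCongr (by omega)))
    (Matrix.fromBlocks (0 : Matrix (Fin r) (Fin r) k) (Fbar p a b) (-(Fbar p a b)ᵀ)
      (0 : Matrix (Fin (r + h)) (Fin (r + h)) k))

/-- The matrix `F`, of order `2r + h`, with `c` zero rows and `c` zero columns added at the end;
the resulting order is `n`. For `c = 0` this is `F` itself. -/
def paddedF {r h : ℕ} (p : Parts r h) (c : ℕ) {n : ℕ} (hn : 2 * r + h + c = n) (a b : k) :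
    Matrix (Fin n) (Fin n) k :=
  Matrix.reindex (finSumFinEquiv.trans (finCongr hn)) (finSumFinEquiv.trans (finCongr hn))
    (Matrix.fromBlocks (F p a b) 0 0 (0 : Matrix (Fin c) (Fin c) k))

/-- The matrix `F`, whose order is `2r + h = n`, as an `n × n` matrix. -/
def castF {r h : ℕ} (p : Parts r h) {n : ℕ} (hn : 2 * r + h = n) (a b : k) :
    Matrix (Fin n) (Fin n) k :=
  Matrix.reindex (finCongr hn) (finCongr hn) (F p a b)

end Blocks

section Spaces

variable {k : Type*} [Field k] {n : ℕ}

/-- `M` is a two-dimensional vector space of skew-symmetric matrices of constant rank `s`: every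
nonzero matrix in `M` has rank `s`. -/
structure IsConstRankPencil (M : Submodule k (Matrix (Fin n) (Fin n) k)) (s : ℕ) : Prop where
  skew : ∀ A ∈ M, Aᵀ = -A
  finrank_eq : Module.finrank k M = 2
  rank_eq : ∀ A ∈ M, A ≠ 0 → A.rank = s

/-- The kernels of the matrices of `M` intersect in zero, and their images generate the whole
space. -/
def Nondegenerate (M : Submodule k (Matrix (Fin n) (Fin n) k)) : Prop :=
  (⨅ A ∈ M, LinearMap.ker (Matrix.mulVecLin A)) = ⊥ ∧
    (⨆ A ∈ M, LinearMap.range (Matrix.mulVecLin A)) = ⊤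

/-- The congruence `A ↦ g A gᵀ`. -/
def congruence (g : Matrix (Fin n) (Fin n) k) :
    Matrix (Fin n) (Fin n) k →ₗ[k] Matrix (Fin n) (Fin n) k where
  toFun A := g * A * gᵀ
  map_add' A B := by rw [Matrix.mul_add, Matrix.add_mul]
  map_smul' c A := by simp

/-- Two spaces of matrices lie in the same orbit of the special linear group acting by
congruence. -/
def SLEquivalent (M M' : Submodule k (Matrix (Fin n) (Fin n) k)) : Prop :=
  ∃ g : Matrix.SpecialLinearGroup (Fin n) k,
    M.map (congruence (g : Matrix (Fin n) (Fin n) k)) = M'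

/-- The pencils `aA + bB` and `aA₁ + bB₁` are congruent by a matrix of determinant one. -/
def SLCongruentPencils (A B A₁ B₁ : Matrix (Fin n) (Fin n) k) : Prop :=
  ∃ g : Matrix.SpecialLinearGroup (Fin n) k, ∀ a b : k,
    congruence (g : Matrix (Fin n) (Fin n) k) (a • A + b • B) = a • A₁ + b • B₁

/-- The pencils `aA + bB` and `aA₁ + bB₁` are strictly equivalent. -/
def StrictlyEquivalent (A B A₁ B₁ : Matrix (Fin n) (Fin n) k) : Prop :=
  ∃ P Q : Matrix.GeneralLinearGroup (Fin n) k, ∀ a b : k,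
    (P : Matrix (Fin n) (Fin n) k) * (a • A + b • B) * (Q : Matrix (Fin n) (Fin n) k) =
      a • A₁ + b • B₁

/-- The vector space of matrices spanned by the values of a matrix of linear forms in `a, b`. -/
def spaceOf (L : k → k → Matrix (Fin n) (Fin n) k) : Submodule k (Matrix (Fin n) (Fin n) k) :=
  Submodule.span k (Set.range fun x : k × k => L x.1 x.2)

end Spaces

end SkewPencil

/-!
A two-dimensional space of skew-symmetric matrices with basis `A, B` is a pencil of alternating
forms `aA + bB` on `V = kⁿ`, and constant rank `2r` says that every nonzero member of the pencil has
a radical of dimension `d = n - 2r`. The classification rests on three facts.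

First, there is a subspace `E` of dimension `n - r` isotropic for all the forms at once
(`exists_common_isotropic`). Constancy of the rank forces the radical of `A` to be isotropic for
`B` (`apply_eq_zero_of_mem_ker`), since otherwise a nearby form would have larger rank. Hence passing
to the hyperplane orthogonal for `B` to a vector in the radical of `A`, but not of `B`, keeps the
corank constant, and `E` is found by induction on the dimension. The induction only stops at the
zero pencil, because `k` is algebraically closed.

Second, `E` is its own orthogonal for every member of the pencil, so a complement `W` of `E` is
embedded in the dual of `E` by every nonzero combination of `A` and `B`. Pairs of maps `W → Dual E`
with this property are direct sums of the blocks `U_s`, `s ≥ 0`, as Kronecker showed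
(`exists_isKroneckerBasis`). Here this is an induction on `dim W`, replacing the pair `f, g` by the
two projections of `{(x, y) | g x = f y}` to `W`.

Third, adding suitable vectors of `E` to the basis of `W` makes `W` isotropic too: the equations for
the correction can be solved recursively along the chains (`exists_sub_swap_eq`). The blocks with
`s = 0` are the zero rows and columns, and they are absent exactly when the space is nondegenerate.
The congruence is brought to determinant one with the automorphisms `diag(t, t⁻¹, 1)` of `F`, whose
determinant is `t⁻ʰ` with `h ≥ 1`.

Conversely, the rows of the block matrix of the `U_s` are independent for all `(a, b) ≠ 0`
(`vecMul_blockU_injective`), so that `F` has constant rank `2r`.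
-/

namespace SkewPencil

open Module

universe u

/-! ### Kronecker bases of injective pencils -/

section Chains

variable {k : Type u} [Field k]

/-- If `f` is injective and its image contains that of `g`, then `f⁻¹ ∘ g` is an endomorphism, and an
eigenvector of it is a vector on which `f` and `g` are proportional. -/
theorem exists_eq_smul_of_range_le [IsAlgClosed k] {W E : Type*} [AddCommGroup W] [Module k W]
    [FiniteDimensional k W] [Nontrivial W] [AddCommGroup E] [Module k E] (f g : W →ₗ[k] E)
    (hf : Function.Injective f) (h : LinearMap.range g ≤ LinearMap.range f) :
    ∃ (μ : k) (w : W), w ≠ 0 ∧ g w = μ • f w := by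
  let T : End k W := (LinearEquiv.ofInjective f hf).symm.toLinearMap ∘ₗ
    g.codRestrict (LinearMap.range f) fun w => h ⟨w, rfl⟩
  obtain ⟨μ, hμ⟩ := End.exists_eigenvalue T
  obtain ⟨w, hw⟩ := hμ.exists_hasEigenvector
  refine ⟨μ, w, hw.2, ?_⟩
  have h1 : (LinearEquiv.ofInjective f hf) (T w) = (LinearEquiv.ofInjective f hf) (μ • w) :=
    congrArg _ hw.apply_eq_smul
  have h2 := congrArg Subtype.val h1
  simpa [T] using h2

/-- Two linear maps `f, g : W → E` all of whose nontrivial linear combinations are injective. -/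
def InjectivePencil {W E : Type*} [AddCommGroup W] [Module k W] [AddCommGroup E] [Module k E]
    (f g : W →ₗ[k] E) : Prop :=
  ∀ a b : k, ¬(a = 0 ∧ b = 0) → ∀ w, a • f w + b • g w = 0 → w = 0

/-- A Kronecker basis for the pair `f, g : W → E`: chains `w i 0, …, w i (r i - 1)` in `W` and
`e i 0, …, e i (r i)` in `E` with `f (w i j) = e i j` and `g (w i j) = e i (j + 1)`. Both families
span and have as many members as the dimension, so they are bases. The values of `w i` and `e i`
beyond the stated ranges are irrelevant. -/
structure IsKroneckerBasis {W E : Type*} [AddCommGroup W] [Module k W] [AddCommGroup E] [Module k E]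
    (f g : W →ₗ[k] E) {ι : Type} [Fintype ι] (r : ι → ℕ) (w : ι → ℕ → W) (e : ι → ℕ → E) :
    Prop where
  map_left : ∀ i j, j < r i → f (w i j) = e i j
  map_right : ∀ i j, j < r i → g (w i j) = e i (j + 1)
  span_left : Submodule.span k {x | ∃ i, ∃ j < r i, w i j = x} = ⊤
  span_right : Submodule.span k {x | ∃ i, ∃ j ≤ r i, e i j = x} = ⊤
  sum_left : ∑ i, r i = finrank k W
  sum_right : ∑ i, (r i + 1) = finrank k E

/-- Kronecker's normal form for injective pencils. The pair `f, g : W → E` is reduced to the pair of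
projections `W₁ → W` of the fibre product `W₁ = {(x, y) | g x = f y}`, which is again an injective
pencil. Applying `f` and `g` to the upper chains `x i 0, …, x i (s i)` of a Kronecker basis of the
reduced pair prolongs them by one vector: `f (x i 0)`, `f (x i 1) = g (x i 0)`, …, `g (x i (s i))`
is a chain in `E` lying over the chain `x i 0, …, x i (s i)` in `W`. Counting dimensions shows that
these chains, together with a basis of a complement of `range f + range g`, are a basis. -/
theorem exists_isKroneckerBasis [IsAlgClosed k] {W E : Type u} [AddCommGroup W] [Module k W]
    [FiniteDimensional k W] [AddCommGroup E] [Module k E] [FiniteDimensional k E]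
    (f g : W →ₗ[k] E) (hfg : InjectivePencil f g) :
    ∃ (ι : Type) (_ : Fintype ι) (r : ι → ℕ) (w : ι → ℕ → W) (e : ι → ℕ → E),
      IsKroneckerBasis f g r w e := by
  induction hd : finrank k W using Nat.strong_induction_on generalizing W E with
  | _ d ih =>
  have hfinj : Function.Injective f := by
    rw [injective_iff_map_eq_zero]
    intro w hw
    exact hfg 1 0 (by simp) w (by simp [hw])
  -- a complement of the sum of the images contributes chains of length zero
  obtain ⟨C, hC⟩ := Submodule.exists_isCompl (LinearMap.range f ⊔ LinearMap.range g)
  have hCd := Submodule.finrank_add_eq_of_isCompl hC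
  let bC := finBasis k C
  have hbC : Submodule.span k (Set.range fun i => (bC i : E)) = C := by
    have := congrArg (Submodule.map C.subtype) bC.span_eq
    rw [Submodule.map_span, Submodule.map_top, Submodule.range_subtype] at this
    rw [← Set.range_comp] at this
    exact this
  rcases subsingleton_or_nontrivial W with hW | hW
  · refine ⟨Fin (finrank k C), inferInstance, fun _ => 0, fun _ _ => 0, fun i _ => bC i, ?_⟩
    have hf0 : f = 0 := LinearMap.ext fun w => by simp [Subsingleton.elim w 0]
    have hg0 : g = 0 := LinearMap.ext fun w => by simp [Subsingleton.elim w 0]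
    subst hf0 hg0
    have hCtop : C = ⊤ := by
      have := hC.sup_eq_top
      simpa using this
    refine ⟨by simp, by simp, Subsingleton.elim _ _, ?_, by simp [finrank_zero_of_subsingleton], ?_⟩
    · refine Eq.trans ?_ (hbC.trans hCtop)
      congr 1
      ext x
      simp
    · rw [← finrank_top k E, ← hCtop]
      simp
  · -- the reduced pair consists of the two projections of `{(x, y) | g x = f y}`
    let W₁ : Submodule k (W × W) := LinearMap.ker (g.coprod (-f))
    have hmem : ∀ p : W₁, g p.1.1 = f p.1.2 := fun p => by
      have := p.2
      simp only [W₁, LinearMap.mem_ker, LinearMap.coprod_apply, LinearMap.neg_apply] at this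
      exact add_neg_eq_zero.1 this
    let f₁ : W₁ →ₗ[k] W := LinearMap.fst k W W ∘ₗ W₁.subtype
    let g₁ : W₁ →ₗ[k] W := LinearMap.snd k W W ∘ₗ W₁.subtype
    have hrange : LinearMap.range (g.coprod (-f)) = LinearMap.range f ⊔ LinearMap.range g := by
      rw [LinearMap.range_coprod, LinearMap.range_neg, sup_comm]
    have hdim := LinearMap.finrank_range_add_finrank_ker (g.coprod (-f))
    rw [hrange, finrank_prod] at hdim
    -- `W₁` has smaller dimension than `W`: otherwise `f` and `g` have the same image and are
    -- proportional on some nonzero vector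
    have hlt : finrank k W < finrank k ↥(LinearMap.range f ⊔ LinearMap.range g) := by
      by_contra hle
      have hEq : LinearMap.range f = LinearMap.range f ⊔ LinearMap.range g := by
        apply Submodule.eq_of_le_of_finrank_le le_sup_left
        rw [LinearMap.finrank_range_of_inj hfinj]
        omega
      obtain ⟨μ, w, hw, h⟩ := exists_eq_smul_of_range_le f g hfinj (hEq ▸ le_sup_right)
      exact hw (hfg μ (-1) (by simp) w (by simp [h]))
    have hinj₁ : InjectivePencil f₁ g₁ := by
      intro a b hab p hp
      have hp' : a • p.1.1 + b • p.1.2 = 0 := hp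
      have hm := hmem p
      have h1 : p.1.1 = 0 := hfg a b hab _ (by
        rw [hm, ← map_smul, ← map_smul, ← map_add, hp', map_zero])
      have h2 : p.1.2 = 0 := hfg a b hab _ (by
        rw [← hm, ← map_smul, ← map_smul, ← map_add, hp', map_zero])
      exact Subtype.ext (Prod.ext h1 h2)
    obtain ⟨ι, _, s, u, x, hx⟩ := ih (finrank k W₁)
      (by change finrank k (LinearMap.ker _) < d; omega) f₁ g₁ hinj₁ rfl
    refine ⟨ι ⊕ Fin (finrank k C), inferInstance, Sum.elim (fun i => s i + 1) 0,
      Sum.elim x fun _ _ => 0,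
      Sum.elim (fun i j => if j ≤ s i then f (x i j) else g (x i (s i))) fun i _ => bC i, ?_⟩
    have hlink : ∀ i j, j < s i → g (x i j) = f (x i (j + 1)) := by
      intro i j hj
      rw [← hx.map_left i j hj, ← hx.map_right i j hj]
      exact hmem _
    have hcard : ∑ i, (s i + 1) = finrank k W := hx.sum_right
    refine ⟨?_, ?_, ?_, ?_, ?_, ?_⟩
    · rintro (i | i) j hj
      · simp only [Sum.elim_inl] at hj ⊢
        rw [if_pos (by omega)]
      · simp at hj
    · rintro (i | i) j hj
      · simp only [Sum.elim_inl] at hj ⊢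
        split_ifs with h
        · exact hlink i j h
        · rw [show j = s i by omega]
      · simp at hj
    · rw [eq_top_iff, ← hx.span_right]
      apply Submodule.span_mono
      rintro _ ⟨i, j, hj, rfl⟩
      exact ⟨Sum.inl i, j, by simp; omega, rfl⟩
    · generalize hS : Submodule.span k (_ : Set E) = S
      have hf : ∀ w, f w ∈ S := by
        have : (⊤ : Submodule k W) ≤ S.comap f := by
          rw [← hx.span_right, Submodule.span_le]
          rintro _ ⟨i, j, hj, rfl⟩
          exact hS ▸ Submodule.subset_span ⟨Sum.inl i, j, by simp; omega, by simp [hj]⟩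
        exact fun w => this trivial
      have hg : ∀ w, g w ∈ S := by
        have : (⊤ : Submodule k W) ≤ S.comap g := by
          rw [← hx.span_right, Submodule.span_le]
          rintro _ ⟨i, j, hj, rfl⟩
          rcases hj.lt_or_eq with hj | rfl
          · simp only [Submodule.comap_coe, Set.mem_preimage, hlink i j hj]
            exact hf _
          · exact hS ▸ Submodule.subset_span ⟨Sum.inl i, s i + 1, by simp, by simp⟩
        exact fun w => this trivial
      rw [eq_top_iff, ← hC.sup_eq_top]
      refine sup_le (sup_le ?_ ?_) ?_
      · rintro _ ⟨w, rfl⟩; exact hf w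
      · rintro _ ⟨w, rfl⟩; exact hg w
      · rw [← hbC, Submodule.span_le]
        rintro _ ⟨i, rfl⟩
        exact hS ▸ Submodule.subset_span ⟨Sum.inr i, 0, by simp, rfl⟩
    · simpa using hcard
    · have h1 : ∑ i, (s i + 1 + 1) = finrank k W + Fintype.card ι := by
        rw [Finset.sum_add_distrib, hcard]; simp
      have h2 : ∑ i, (s i + 1) = finrank k W₁ + Fintype.card ι := by
        rw [Finset.sum_add_distrib, hx.sum_left]; simp
      have h3 : finrank k W₁ = finrank k (LinearMap.ker (g.coprod (-f))) := rfl
      simp only [Fintype.sum_sum_type, Sum.elim_inl, Sum.elim_inr, h1]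
      simp
      omega

end Chains

/-! ### Alternating pencils of constant corank -/

section Alternating

variable {k : Type u} [Field k] {V : Type u} [AddCommGroup V] [Module k V] [FiniteDimensional k V]

/-- Semicontinuity of the rank: all but finitely many of the maps `D₀ + t D₁` have a kernel of
dimension at most that of `ker D₀`; in particular one with `t ≠ 0` has. -/
theorem exists_finrank_ker_add_smul_le [Infinite k] {V' : Type*} [AddCommGroup V'] [Module k V']
    (D₀ D₁ : V →ₗ[k] V') :
    ∃ t : k, t ≠ 0 ∧ finrank k (LinearMap.ker (D₀ + t • D₁)) ≤ finrank k (LinearMap.ker D₀) := by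
  obtain ⟨S, hS⟩ := Submodule.exists_isCompl (LinearMap.ker D₀)
  have hker : LinearMap.ker (D₀.domRestrict S) = ⊥ := by
    rw [LinearMap.ker_eq_bot']
    intro s hs
    exact Subtype.ext (Submodule.disjoint_def.1 hS.disjoint s.1 hs s.2)
  obtain ⟨L, hL⟩ := LinearMap.exists_leftInverse_of_injective _ hker
  let X : End k S := L ∘ₗ D₁.domRestrict S
  -- on a complement of the kernel, `D₀ + t D₁` is injective unless `-t⁻¹` is an eigenvalue of `X`
  obtain ⟨s, hs⟩ := (X.finite_hasEigenvalue.union (Set.finite_singleton (0 : k))).exists_notMem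
  simp only [Set.mem_union, Set.mem_ofPred_eq, Set.mem_singleton_iff, not_or] at hs
  refine ⟨-s⁻¹, by simpa using hs.2, ?_⟩
  have hdisj : Disjoint (LinearMap.ker (D₀ + (-s⁻¹) • D₁)) S := by
    rw [Submodule.disjoint_def]
    intro v hv hvS
    by_contra hv0
    apply hs.1
    refine End.hasEigenvalue_of_hasEigenvector (x := (⟨v, hvS⟩ : S))
      ⟨End.mem_eigenspace_iff.2 ?_, fun h => hv0 (congrArg Subtype.val h)⟩
    have h1 : L (D₀ v) = ⟨v, hvS⟩ := LinearMap.congr_fun hL ⟨v, hvS⟩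
    have h2 : D₀ v + (-s⁻¹) • D₁ v = 0 := hv
    have h3 := congrArg L h2
    rw [map_add, map_smul, h1, map_zero] at h3
    change L (D₁ v) = _
    rw [eq_neg_of_add_eq_zero_left h3, neg_smul, neg_neg, smul_smul, mul_inv_cancel₀ hs.2,
      one_smul]
  have h1 := Submodule.finrank_add_finrank_le_of_disjoint hdisj
  have h2 := Submodule.finrank_add_eq_of_isCompl hS
  omega

/-- If the rank does not change in the direction `B` at `A`, then the kernel of `A` is isotropic
for `B`: otherwise rescaling the block of `A + t B` on `ker A` by `t⁻¹` exhibits, in the limit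
`t → 0`, a form of larger rank. -/
theorem apply_eq_zero_of_mem_ker [Infinite k] {A B : V →ₗ[k] V →ₗ[k] k} (hA : A.IsAlt)
    (hconst : ∀ t : k, finrank k (LinearMap.ker (A + t • B)) = finrank k (LinearMap.ker A))
    {x y : V} (hx : A x = 0) (hy : A y = 0) : B x y = 0 := by
  obtain ⟨p, hp⟩ := LinearMap.exists_leftInverse_of_injective (LinearMap.ker A).subtype
    (Submodule.ker_subtype _)
  -- `ρ` is a projection onto `ker A`; for `t ≠ 0` the map `D₀ + t D₁` below is `A + t B` with the
  -- values on `ker A` multiplied by `t⁻¹`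
  let ρ : V →ₗ[k] V := (LinearMap.ker A).subtype ∘ₗ p
  have hρ : ∀ z, A z = 0 → ρ z = z := fun z hz =>
    congrArg Subtype.val (LinearMap.congr_fun hp (⟨z, hz⟩ : LinearMap.ker A))
  have hAρ : ∀ z, A (ρ z) = 0 := fun z => (p z).2
  have hAρ' : ∀ v z, A v (ρ z) = 0 := fun v z => by rw [← hA.neg, hAρ]; simp
  obtain ⟨t, ht, hle⟩ := exists_finrank_ker_add_smul_le (A + B.compl₂ ρ) (B - B.compl₂ ρ)
  have h1 : LinearMap.ker (A + t • B) ≤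
      LinearMap.ker (A + B.compl₂ ρ + t • (B - B.compl₂ ρ)) := by
    intro v hv
    have hv' : ∀ z, A v z + t * B v z = 0 := fun z => LinearMap.congr_fun hv z
    have h0 : ∀ z, B v (ρ z) = 0 := fun z => by
      have := hv' (ρ z)
      rw [hAρ', zero_add] at this
      exact (mul_eq_zero.1 this).resolve_left ht
    refine LinearMap.ext fun z => ?_
    simp [h0, hv']
  have h2 : LinearMap.ker (A + B.compl₂ ρ) ≤ LinearMap.ker A := by
    intro v hv
    have hv' : ∀ z, A v z + B v (ρ z) = 0 := fun z => LinearMap.congr_fun hv z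
    refine LinearMap.ext fun z => ?_
    have h0 := hv' (ρ z)
    rw [hAρ', hρ _ (hAρ z), zero_add] at h0
    simpa [h0] using hv' z
  have h3 : LinearMap.ker (A + B.compl₂ ρ) = LinearMap.ker A := by
    apply Submodule.eq_of_le_of_finrank_le h2
    rw [← hconst t]
    exact (Submodule.finrank_mono h1).trans hle
  have h4 : x ∈ LinearMap.ker (A + B.compl₂ ρ) := h3 ▸ hx
  have h5 := LinearMap.congr_fun h4 y
  simpa [hx, hρ y hy] using h5

theorem range_eq_dualAnnihilator_ker {A : V →ₗ[k] V →ₗ[k] k} (hA : A.IsAlt) :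
    LinearMap.range A = (LinearMap.ker A).dualAnnihilator := by
  apply Submodule.eq_of_le_of_finrank_le
  · rintro _ ⟨v, rfl⟩
    rw [Submodule.mem_dualAnnihilator]
    intro w hw
    rw [← hA.neg, LinearMap.mem_ker.1 hw]
    simp
  · have h1 := LinearMap.finrank_range_add_finrank_ker A
    have h2 := Subspace.finrank_add_finrank_dualAnnihilator_eq (LinearMap.ker A)
    exact (Nat.add_right_cancel (h1.trans (h2.symm.trans (Nat.add_comm _ _)))).ge

/-- Restricting an alternating form `C` to the hyperplane orthogonal to a vector `y` outside its
radical enlarges the radical by the line through `y`. -/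
theorem finrank_ker_restrict {C : V →ₗ[k] V →ₗ[k] k} (hC : C.IsAlt) {y : V} (hy : C y ≠ 0) :
    finrank k (LinearMap.ker
      (C.domRestrict₁₂ (LinearMap.ker (C y)) (LinearMap.ker (C y)))) =
      finrank k (LinearMap.ker C) + 1 := by
  have hmap : (LinearMap.ker (C.domRestrict₁₂ (LinearMap.ker (C y)) (LinearMap.ker (C y)))).map
      (LinearMap.ker (C y)).subtype = LinearMap.ker C ⊔ Submodule.span k {y} := by
    ext v
    rw [Submodule.mem_map, Submodule.mem_sup]
    constructor
    · rintro ⟨⟨v, hv⟩, hvk, rfl⟩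
      have hle : LinearMap.ker (C y) ≤ LinearMap.ker (C v) := fun z hz =>
        LinearMap.congr_fun hvk ⟨z, hz⟩
      obtain ⟨c, hc⟩ : ∃ c : k, c • C y = C v := by
        have := mem_span_of_iInf_ker_le_ker (ι := Unit) (L := fun _ => C y) (K := C v)
          (by simpa using hle)
        simpa [Submodule.mem_span_singleton] using this
      exact ⟨v - c • y, by simp [hc], c • y, Submodule.smul_mem _ _
        (Submodule.mem_span_singleton_self y), by simp⟩
    · rintro ⟨z, hz, z', hz', rfl⟩
      obtain ⟨c, rfl⟩ := Submodule.mem_span_singleton.1 hz'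
      have hz0 : C z = 0 := hz
      refine ⟨⟨z + c • y, ?_⟩, ?_, rfl⟩
      · rw [LinearMap.mem_ker, map_add, map_smul, hC y, ← hC.neg, hz0]
        simp
      · refine LinearMap.ext fun q => ?_
        have hq : C y q = 0 := q.2
        change C (z + c • y) q = 0
        simp [hz0, hq]
  have hfin : finrank k ((LinearMap.ker (C.domRestrict₁₂ (LinearMap.ker (C y))
      (LinearMap.ker (C y)))).map (LinearMap.ker (C y)).subtype) = _ :=
    Submodule.finrank_map_subtype_eq _ _
  rw [← hfin, hmap]
  have h1 := Submodule.finrank_sup_add_finrank_inf_eq (LinearMap.ker C) (Submodule.span k {y})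
  have h2 : LinearMap.ker C ⊓ Submodule.span k {y} = ⊥ := by
    rw [← disjoint_iff, Submodule.disjoint_span_singleton]
    intro h
    exact absurd h hy
  have hy0 : y ≠ 0 := by rintro rfl; simp at hy
  rw [h2, finrank_bot, finrank_span_singleton hy0] at h1
  omega

end Alternating

section Lagrangian

variable {k : Type u} [Field k]

/-- All nontrivial combinations of the forms `A` and `B` have a radical of dimension `d`. -/
def HasConstCorank {V : Type*} [AddCommGroup V] [Module k V] (A B : V →ₗ[k] V →ₗ[k] k) (d : ℕ) :
    Prop :=
  ∀ a b : k, ¬(a = 0 ∧ b = 0) → finrank k (LinearMap.ker (a • A + b • B)) = d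

theorem HasConstCorank.left {V : Type*} [AddCommGroup V] [Module k V] {A B : V →ₗ[k] V →ₗ[k] k}
    {d : ℕ} (hd : HasConstCorank A B d) : finrank k (LinearMap.ker A) = d := by
  have := hd 1 0 (by simp)
  rwa [one_smul, zero_smul, add_zero] at this

theorem HasConstCorank.right {V : Type*} [AddCommGroup V] [Module k V] {A B : V →ₗ[k] V →ₗ[k] k}
    {d : ℕ} (hd : HasConstCorank A B d) : finrank k (LinearMap.ker B) = d := by
  have := hd 0 1 (by simp)
  rwa [one_smul, zero_smul, zero_add] at this

/-- Unless `A = 0`, the radical of `A` is not contained in that of `B`. If it were, the two would be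
equal, and on a complement `B` would be proportional to `A` at some nonzero vector, which enlarges
the radical of one member of the pencil. -/
theorem exists_mem_ker_apply_ne_zero [IsAlgClosed k] {V : Type u} [AddCommGroup V] [Module k V]
    [FiniteDimensional k V] {A B : V →ₗ[k] V →ₗ[k] k} (hA : A.IsAlt) (hB : B.IsAlt) {d : ℕ}
    (hd : HasConstCorank A B d) (hA0 : A ≠ 0) : ∃ x, A x = 0 ∧ B x ≠ 0 := by
  by_contra! hx
  have hkA : finrank k (LinearMap.ker A) = d := hd.left
  have hkB : finrank k (LinearMap.ker B) = d := hd.right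
  have hker : LinearMap.ker A = LinearMap.ker B :=
    Submodule.eq_of_le_of_finrank_le hx (by omega)
  obtain ⟨S, hS⟩ := Submodule.exists_isCompl (LinearMap.ker A)
  have hSA : ∀ s : S, A s = 0 → s = 0 := fun s hs =>
    Subtype.ext (Submodule.disjoint_def.1 hS.disjoint s.1 hs s.2)
  have hSn : Nontrivial S := by
    by_contra hn
    rw [not_nontrivial_iff_subsingleton] at hn
    have : S = ⊥ := Submodule.eq_bot_of_subsingleton
    rw [this] at hS
    exact hA0 (LinearMap.ker_eq_top.1 (eq_top_of_isCompl_bot hS))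
  obtain ⟨μ, s, hs0, hs⟩ := exists_eq_smul_of_range_le (A.domRestrict S) (B.domRestrict S)
    ((injective_iff_map_eq_zero _).2 hSA) (by
      rintro _ ⟨s, rfl⟩
      have : B s ∈ LinearMap.range A := by
        rw [range_eq_dualAnnihilator_ker hA, hker, ← range_eq_dualAnnihilator_ker hB]
        exact ⟨s, rfl⟩
      obtain ⟨v, hv⟩ := this
      have hvtop : v ∈ LinearMap.ker A ⊔ S := hS.sup_eq_top ▸ Submodule.mem_top
      obtain ⟨z, hz, s', hs', rfl⟩ := Submodule.mem_sup.1 hvtop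
      refine ⟨⟨s', hs'⟩, ?_⟩
      have hz0 : A z = 0 := hz
      simpa [hz0] using hv)
  -- `s` lies in the radical of `B - μ A`, which is the common radical of `A` and `B`
  have hle : LinearMap.ker A ≤ LinearMap.ker ((-μ) • A + (1 : k) • B) := by
    intro v hv
    have h1 : A v = 0 := hv
    have h2 : B v = 0 := hx v hv
    simp [h1, h2]
  have heq := Submodule.eq_of_le_of_finrank_le hle (by rw [hd _ _ (by simp), hkA])
  have hs' : (s : V) ∈ LinearMap.ker ((-μ) • A + (1 : k) • B) := by
    have : B s = μ • A s := hs
    simp [this]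
  rw [← heq] at hs'
  exact hs0 (hSA s hs')

/-- A pencil of alternating forms of constant corank has a common isotropic subspace of the largest
dimension that a single form of this corank allows. If `x` is in the radical of `A` but not in that
of `B`, then on the hyperplane orthogonal to `x` for `B` the pencil has again constant corank,
larger by one: for every member `C` of the pencil this is the hyperplane orthogonal for `C` to some
vector outside the radical of `C`. For the multiples of `A` this is where the radical of `A` being
isotropic for `B` is needed. -/
theorem exists_common_isotropic [IsAlgClosed k] {V : Type u} [AddCommGroup V] [Module k V]
    [FiniteDimensional k V] {A B : V →ₗ[k] V →ₗ[k] k} (hA : A.IsAlt) (hB : B.IsAlt) {d : ℕ}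
    (hd : HasConstCorank A B d) :
    ∃ E : Submodule k V, (∀ x ∈ E, ∀ y ∈ E, A x y = 0 ∧ B x y = 0) ∧
      2 * finrank k E = finrank k V + d := by
  induction hn : finrank k V generalizing V d with
  | zero =>
    refine ⟨⊤, fun x _ y _ => ?_, ?_⟩
    · have := finrank_zero_iff.1 hn
      simp [Subsingleton.elim x 0]
    · have := hd 1 0 (by simp)
      have h2 := Submodule.finrank_le (LinearMap.ker ((1 : k) • A + (0 : k) • B))
      rw [finrank_top]
      omega
  | succ n ih =>
  have hkA : finrank k (LinearMap.ker A) = d := hd.left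
  have hkB : finrank k (LinearMap.ker B) = d := hd.right
  by_cases hA0 : A = 0
  · have hdn : d = finrank k V := by rw [← hkA, hA0, LinearMap.ker_zero, finrank_top]
    have hB0 : B = 0 := LinearMap.ker_eq_top.1 (Submodule.eq_top_of_finrank_eq (by omega))
    exact ⟨⊤, by simp [hA0, hB0], by rw [finrank_top]; omega⟩
  obtain ⟨x, hxA, hxB⟩ := exists_mem_ker_apply_ne_zero hA hB hd hA0
  -- restrict to the hyperplane orthogonal to `x`
  let H := LinearMap.ker (B x)
  have hH : finrank k H + 1 = n + 1 :=
    hn ▸ Module.Dual.finrank_ker_add_one_of_ne_zero hxB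
  have hd' : HasConstCorank (A.domRestrict₁₂ H H) (B.domRestrict₁₂ H H) (d + 1) := by
    intro a b hab
    have hCalt : (a • A + b • B).IsAlt := fun v => by simp [hA v, hB v]
    obtain ⟨y, hy⟩ : ∃ y, (a • A + b • B) y = B x := by
      by_cases hb : b = 0
      · have ha : a ≠ 0 := fun ha => hab ⟨ha, hb⟩
        have hmem : B x ∈ LinearMap.range A := by
          rw [range_eq_dualAnnihilator_ker hA, Submodule.mem_dualAnnihilator]
          intro z hz
          refine apply_eq_zero_of_mem_ker hA (fun t => ?_) hxA hz
          rw [hkA, ← hd 1 t (by simp), one_smul]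
        obtain ⟨y, hy⟩ := hmem
        exact ⟨a⁻¹ • y, by simp [hb, hy, smul_smul, ha]⟩
      · exact ⟨b⁻¹ • x, by simp [hxA, smul_smul, hb]⟩
    have hres := finrank_ker_restrict hCalt (y := y) (by rwa [hy])
    rw [hy, hd a b hab] at hres
    exact hres
  obtain ⟨E, hE, hEd⟩ := ih (V := H) (A := A.domRestrict₁₂ H H) (B := B.domRestrict₁₂ H H)
    (fun v => hA v) (fun v => hB v) hd' (by omega)
  refine ⟨E.map H.subtype, ?_, ?_⟩
  · rintro _ ⟨x, hx, rfl⟩ _ ⟨y, hy, rfl⟩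
    exact hE x hx y hy
  · rw [Submodule.finrank_map_subtype_eq]
    omega

/-- An isotropic subspace of the largest possible dimension is its own orthogonal. -/
theorem mem_of_forall_apply_eq_zero {V : Type u} [AddCommGroup V] [Module k V]
    [FiniteDimensional k V] {C : V →ₗ[k] V →ₗ[k] k} {E : Submodule k V}
    (hE : ∀ x ∈ E, ∀ y ∈ E, C x y = 0)
    (hEd : 2 * finrank k E = finrank k V + finrank k (LinearMap.ker C)) {w : V}
    (hw : ∀ y ∈ E, C w y = 0) : w ∈ E := by
  let P := E.dualAnnihilator.comap C
  have hEP : E ≤ P := fun x hx => (Submodule.mem_dualAnnihilator _).2 (hE x hx)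
  have h1 := LinearMap.finrank_range_add_finrank_ker (C.domRestrict P)
  have h2 : finrank k (LinearMap.range (C.domRestrict P)) ≤ finrank k E.dualAnnihilator := by
    apply Submodule.finrank_mono
    rintro _ ⟨x, rfl⟩
    exact x.2
  have h3 : finrank k (LinearMap.ker (C.domRestrict P)) ≤ finrank k (LinearMap.ker C) := by
    rw [← Submodule.finrank_map_subtype_eq P (LinearMap.ker (C.domRestrict P))]
    apply Submodule.finrank_mono
    rintro _ ⟨x, hx, rfl⟩
    exact hx
  have h4 := Subspace.finrank_add_finrank_dualAnnihilator_eq E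
  rw [Submodule.eq_of_le_of_finrank_le hEP (by omega)]
  exact (Submodule.mem_dualAnnihilator _).2 hw

end Lagrangian

/-! ### The normal form of an alternating pencil -/

section Normal

variable {k : Type u} [Field k]

/-- The system of linear equations solved by the correction that makes a complement isotropic. The
indices of the unknowns and of the equations run over all natural numbers, so that the recursion
that solves it has no boundary conditions. -/
theorem exists_sub_swap_eq [CharZero k] {ι : Type*} (a b : ι → ℕ → ι → ℕ → k)
    (ha : ∀ i j i' j', a i' j' i j = -a i j i' j') (hb : ∀ i j i' j', b i' j' i j = -b i j i' j') :
    ∃ φ : ι → ℕ → ι → ℕ → k,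
      (∀ i j i' j', φ i j i' j' - φ i' j' i j = a i j i' j') ∧
      ∀ i j i' j', φ i j i' (j' + 1) - φ i' j' i (j + 1) = b i j i' j' := by
  -- two unrelated unknowns `G`, `H` in place of `φ` are found by recursion; their average is
  -- a solution because the right-hand sides are skew
  let G : ι → ℕ → ι → ℕ → k := fun i j i' l =>
    Nat.rec (motive := fun _ => ℕ → k) (fun _ => 0)
      (fun l ih j => b i j i' l + ih (j + 1) - a i (j + 1) i' l) l j
  have hG : ∀ i j i' l, G i j i' (l + 1) = b i j i' l + G i (j + 1) i' l - a i (j + 1) i' l :=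
    fun _ _ _ _ => rfl
  let H : ι → ℕ → ι → ℕ → k := fun i' j' i l => G i l i' j' - a i l i' j'
  refine ⟨fun i j i' j' => (G i j i' j' + H i j i' j') / 2, fun i j i' j' => ?_,
    fun i j i' j' => ?_⟩
  · simp only [H]
    rw [ha i j i' j']
    ring
  · simp only [H, hG]
    rw [hb i j i' j']
    ring

/-- A family of vectors in which the alternating forms `A` and `B` take the shape of the matrix of
linear forms `F` with zero rows and columns added: the `w i j` with `j < r i` span an isotropic
subspace, so do the `e i j` with `j ≤ r i`, and between the two `A` and `B` are the coefficients of
`a` and `b` in the block diagonal matrix with blocks `U_{r i}`. A block with `r i = 0` is a zero row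
and column. -/
structure IsSkewKroneckerFamily {V : Type*} [AddCommGroup V] [Module k V]
    (A B : V →ₗ[k] V →ₗ[k] k) {ι : Type} [Fintype ι] (r : ι → ℕ) (w e : ι → ℕ → V) : Prop where
  left_left : ∀ i j i' j', A (w i j) (w i' j') = 0 ∧ B (w i j) (w i' j') = 0
  right_right : ∀ i j i' j', A (e i j) (e i' j') = 0 ∧ B (e i j) (e i' j') = 0
  self : ∀ i j j', j < r i → j' ≤ r i → A (w i j) (e i j') = (if j' = j then 1 else 0) ∧
    B (w i j) (e i j') = if j' = j + 1 then 1 else 0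
  of_ne : ∀ i i' j j', i ≠ i' → j < r i → j' ≤ r i' →
    A (w i j) (e i' j') = 0 ∧ B (w i j) (e i' j') = 0
  span_eq : Submodule.span k ({x | ∃ i, ∃ j < r i, w i j = x} ∪ {x | ∃ i, ∃ j ≤ r i, e i j = x}) = ⊤

/-- A pencil of alternating forms of constant corank `d` has a Kronecker normal form with `d` blocks.
The common isotropic subspace `E` is paired with a complement `W` by an injective pencil
`W → Dual E`; a Kronecker basis of it gives the vectors `w i j` up to a correction in `E`, and the
basis of `E` dual to the upper chains gives the `e i j`. -/
theorem exists_isSkewKroneckerFamily [IsAlgClosed k] [CharZero k] {V : Type u} [AddCommGroup V]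
    [Module k V] [FiniteDimensional k V] {A B : V →ₗ[k] V →ₗ[k] k} (hA : A.IsAlt) (hB : B.IsAlt)
    {d : ℕ} (hd : HasConstCorank A B d) :
    ∃ (ι : Type) (_ : Fintype ι) (r : ι → ℕ) (w e : ι → ℕ → V),
      IsSkewKroneckerFamily A B r w e ∧ Fintype.card ι = d ∧
        2 * ∑ i, r i + d = finrank k V := by
  classical
  obtain ⟨E, hE, hEd⟩ := exists_common_isotropic hA hB hd
  obtain ⟨W, hW⟩ := Submodule.exists_isCompl E
  have hWd := Submodule.finrank_add_eq_of_isCompl hW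
  let f : W →ₗ[k] Dual k E := A.domRestrict₁₂ W E
  let g : W →ₗ[k] Dual k E := B.domRestrict₁₂ W E
  have hfg : InjectivePencil f g := by
    intro a b hab w hw
    have hmem : (w : V) ∈ E := by
      refine mem_of_forall_apply_eq_zero (C := a • A + b • B) (fun x hx y hy => ?_) ?_
        fun y hy => ?_
      · simp [hE x hx y hy]
      · rw [hd a b hab, hEd]
      · exact LinearMap.congr_fun hw ⟨y, hy⟩
    exact Subtype.ext (Submodule.disjoint_def.1 hW.disjoint w.1 hmem w.2)
  obtain ⟨ι, _, r, w, e', h⟩ := exists_isKroneckerBasis f g hfg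
  -- the basis of `E` whose dual basis consists of the upper chains
  have hspan : ⊤ ≤ Submodule.span k (Set.range fun p : Σ i, Fin (r i + 1) => e' p.1 p.2) := by
    rw [← h.span_right]
    apply Submodule.span_mono
    rintro _ ⟨i, j, hj, rfl⟩
    exact ⟨⟨i, j, by omega⟩, rfl⟩
  let bE' : Basis (Σ i, Fin (r i + 1)) k (Dual k E) :=
    basisOfTopLeSpanOfCardEqFinrank _ hspan (by simp [h.sum_right])
  have hbE' : ∀ p, bE' p = e' p.1 p.2 := fun p => by simp [bE']
  let bE : Basis (Σ i, Fin (r i + 1)) k E := bE'.dualBasis.map (evalEquiv k E).symm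
  have hdual : ∀ p q, e' p.1 p.2 (bE q) = if p = q then 1 else 0 := by
    intro p q
    rw [← hbE']
    simp only [bE, Basis.map_apply]
    rw [apply_evalEquiv_symm_apply, Basis.dualBasis_apply_self]
  -- the correction that makes the complement isotropic
  obtain ⟨φ, hφA, hφB⟩ := exists_sub_swap_eq
    (fun i j i' j' => if j < r i ∧ j' < r i' then A (w i j : V) (w i' j' : V) else 0)
    (fun i j i' j' => if j < r i ∧ j' < r i' then B (w i j : V) (w i' j' : V) else 0)
    (fun i j i' j' => by
      simp only [and_comm (a := j' < r i'), ← hA.neg (w i j : V)]; split_ifs <;> simp)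
    (fun i j i' j' => by
      simp only [and_comm (a := j' < r i'), ← hB.neg (w i j : V)]; split_ifs <;> simp)
  let c : ι → ℕ → E := fun i j => ∑ q : Σ i, Fin (r i + 1), φ i j q.1 q.2 • bE q
  have hc : ∀ i j i' j', j' ≤ r i' → e' i' j' (c i j) = φ i j i' j' := by
    intro i j i' j' hj'
    have := fun q => hdual ⟨i', ⟨j', by omega⟩⟩ q
    simp only at this
    simp [c, this]
  have hAc : ∀ i j i' j', j' < r i' → A (w i' j' : V) (c i j : V) = φ i j i' j' := by
    intro i j i' j' hj'
    rw [← hc i j i' j' hj'.le, ← h.map_left i' j' hj']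
    rfl
  have hBc : ∀ i j i' j', j' < r i' → B (w i' j' : V) (c i j : V) = φ i j i' (j' + 1) := by
    intro i j i' j' hj'
    rw [← hc i j i' (j' + 1) hj', ← h.map_right i' j' hj']
    rfl
  let w₁ : ι → ℕ → V := fun i j => if j < r i then (w i j : V) + c i j else 0
  let e₁ : ι → ℕ → V := fun i j => if hj : j < r i + 1 then (bE ⟨i, ⟨j, hj⟩⟩ : V) else 0
  have hw₁ : ∀ i j, j < r i → w₁ i j = (w i j : V) + c i j := fun i j hj => if_pos hj
  have he₁ : ∀ i j (hj : j < r i + 1), e₁ i j = (bE ⟨i, ⟨j, hj⟩⟩ : V) := fun i j hj => dif_pos hj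
  have he₁E : ∀ i j, e₁ i j ∈ E := fun i j => by
    simp only [e₁]
    split_ifs
    · exact Subtype.mem _
    · exact E.zero_mem
  have hwe : ∀ i i' j j' (hj : j < r i) (hj' : j' < r i' + 1),
      A (w₁ i j) (e₁ i' j') = e' i j (bE ⟨i', ⟨j', hj'⟩⟩) ∧
      B (w₁ i j) (e₁ i' j') = e' i (j + 1) (bE ⟨i', ⟨j', hj'⟩⟩) := by
    intro i i' j j' hj hj'
    rw [← h.map_left i j hj, ← h.map_right i j hj, hw₁ i j hj, he₁ i' j' hj']
    simp only [map_add, LinearMap.add_apply]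
    rw [(hE _ (c i j).2 _ (bE ⟨i', ⟨j', hj'⟩⟩).2).1, (hE _ (c i j).2 _ (bE ⟨i', ⟨j', hj'⟩⟩).2).2,
      add_zero, add_zero]
    exact ⟨rfl, rfl⟩
  refine ⟨ι, inferInstance, r, w₁, e₁, ⟨?_, ?_, ?_, ?_, ?_⟩, ?_, ?_⟩
  · intro i j i' j'
    by_cases hj : j < r i
    · by_cases hj' : j' < r i'
      · have hA1 := hφA i j i' j'
        have hB1 := hφB i j i' j'
        simp only [hj, hj', and_self, if_true] at hA1 hB1
        rw [hw₁ i j hj, hw₁ i' j' hj']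
        simp only [map_add, LinearMap.add_apply]
        rw [(hE _ (c i j).2 _ (c i' j').2).1, (hE _ (c i j).2 _ (c i' j').2).2,
          hAc i' j' i j hj, hBc i' j' i j hj, ← hA.neg (w i' j' : V) (c i j),
          ← hB.neg (w i' j' : V) (c i j),
          hAc i j i' j' hj', hBc i j i' j' hj', ← hA1, ← hB1]
        constructor <;> ring
      · simp [w₁, hj']
    · simp [w₁, hj]
  · intro i j i' j'
    exact hE _ (he₁E i j) _ (he₁E i' j')
  · intro i j j' hj hj'
    rw [(hwe i i j j' hj (by omega)).1, (hwe i i j j' hj (by omega)).2]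
    have h1 := hdual ⟨i, ⟨j, by omega⟩⟩ ⟨i, ⟨j', by omega⟩⟩
    have h2 := hdual ⟨i, ⟨j + 1, by omega⟩⟩ ⟨i, ⟨j', by omega⟩⟩
    simp only at h1 h2
    rw [h1, h2]
    simp [eq_comm]
  · intro i i' j j' hi hj hj'
    rw [(hwe i i' j j' hj (by omega)).1, (hwe i i' j j' hj (by omega)).2]
    have h1 := hdual ⟨i, ⟨j, by omega⟩⟩ ⟨i', ⟨j', by omega⟩⟩
    have h2 := hdual ⟨i, ⟨j + 1, by omega⟩⟩ ⟨i', ⟨j', by omega⟩⟩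
    simp only at h1 h2
    rw [h1, h2]
    simp [hi]
  · generalize hS : Submodule.span k (_ : Set V) = S
    have hES : E ≤ S := by
      have h1 : Submodule.span k (Set.range fun q => (bE q : V)) = E := by
        have := congrArg (Submodule.map E.subtype) bE.span_eq
        rw [Submodule.map_span, Submodule.map_top, Submodule.range_subtype, ← Set.range_comp] at this
        exact this
      refine h1.symm.le.trans ?_
      rw [Submodule.span_le]
      rintro _ ⟨⟨i, j⟩, rfl⟩
      exact hS ▸ Submodule.subset_span (Or.inr ⟨i, j, by omega, he₁ i j j.2⟩)
    have hWS : W ≤ S := by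
      have h1 : (⊤ : Submodule k W) ≤ S.comap W.subtype := by
        rw [← h.span_left, Submodule.span_le]
        rintro _ ⟨i, j, hj, rfl⟩
        have h2 : w₁ i j ∈ S := hS ▸ Submodule.subset_span (Or.inl ⟨i, j, hj, rfl⟩)
        rw [hw₁ i j hj] at h2
        exact (Submodule.add_mem_iff_left _ (hES (c i j).2)).1 h2
      exact fun x hx => h1 (x := ⟨x, hx⟩) trivial
    rw [eq_top_iff, ← hW.sup_eq_top]
    exact sup_le hES hWS
  · have h1 := h.sum_right
    have h2 := h.sum_left
    have h3 : finrank k (Dual k E) = finrank k E := Subspace.dual_finrank_eq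
    rw [Finset.sum_add_distrib, h2, h3] at h1
    simp at h1
    omega
  · rw [h.sum_left]
    omega

end Normal

open Matrix

/-! ### Rank and kernels of the matrices `F` -/

section Rank

variable {k : Type*} [Field k]

theorem finrank_submodule_prod {V W : Type*} [AddCommGroup V] [Module k V] [FiniteDimensional k V]
    [AddCommGroup W] [Module k W] [FiniteDimensional k W] (p : Submodule k V) (q : Submodule k W) :
    finrank k (p.prod q) = finrank k p + finrank k q := by
  have h : LinearMap.range (p.subtype.prodMap q.subtype) = p.prod q := by
    rw [LinearMap.range_prodMap, Submodule.range_subtype, Submodule.range_subtype]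
  rw [← h, LinearMap.finrank_range_of_inj, finrank_prod]
  exact Prod.map_injective.2 ⟨p.injective_subtype, q.injective_subtype⟩

theorem rank_fromBlocks_diag {l m n o : Type*} [Fintype l] [Fintype m] [Fintype n] [Fintype o]
    (X : Matrix l m k) (Y : Matrix n o k) : (fromBlocks X 0 0 Y).rank = X.rank + Y.rank := by
  have h : (fromBlocks X 0 0 Y).mulVecLin =
      (LinearEquiv.sumArrowLequivProdArrow l n k k).symm.toLinearMap ∘ₗ
        (X.mulVecLin.prodMap Y.mulVecLin) ∘ₗ
          (LinearEquiv.sumArrowLequivProdArrow m o k k).toLinearMap := by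
    refine LinearMap.ext fun v => ?_
    ext (i | i)
    · simp [fromBlocks_mulVec]; rfl
    · simp [fromBlocks_mulVec]; rfl
  rw [Matrix.rank, h, LinearMap.range_comp, LinearEquiv.finrank_map_eq, LinearEquiv.range_comp,
    LinearMap.range_prodMap, finrank_submodule_prod]
  rfl

theorem rank_fromBlocks_antidiag {l m n o : Type*} [Fintype l] [Fintype m] [Fintype n] [Fintype o]
    (X : Matrix l m k) (Y : Matrix n o k) :
    (fromBlocks 0 X Y 0 : Matrix (l ⊕ n) (o ⊕ m) k).rank = X.rank + Y.rank := by
  have h := rank_submatrix (fromBlocks 0 X Y 0 : Matrix (l ⊕ n) (o ⊕ m) k) (Equiv.refl _)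
    (Equiv.sumComm m o)
  rw [← h, ← rank_fromBlocks_diag]
  congr 1
  exact fromBlocks_submatrix_sum_swap_right _ _ _ _ _

theorem rank_neg_eq {m n : Type*} [Fintype m] [Fintype n] (X : Matrix m n k) :
    (-X).rank = X.rank := by
  have h : (-X).mulVecLin = -X.mulVecLin := LinearMap.ext fun v => by simp
  rw [Matrix.rank, h, LinearMap.range_neg, Matrix.rank]

end Rank

section Model

variable {k : Type*} [CommRing k]

theorem vecMul_U_injective {s : ℕ} [IsDomain k] {a b : k} (hab : ¬(a = 0 ∧ b = 0)) {x : Fin s → k}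
    (hx : x ᵥ* U s a b = 0) : x = 0 := by
  by_cases ha : a = 0
  · have hb : b ≠ 0 := fun hb => hab ⟨ha, hb⟩
    ext j
    have h := congrFun hx j.succ
    simp only [vecMul, dotProduct, U, Matrix.of_apply] at h
    rw [Finset.sum_eq_single j] at h
    · have h1 : j.succ ≠ j.castSucc := (Fin.castSucc_lt_succ).ne'
      simpa [h1, hb] using h
    · intro j' _ hj'
      have h1 : j.succ ≠ j'.succ := fun h => hj' (Fin.succ_injective _ h).symm
      simp [ha, h1]
    · simp
  · suffices H : ∀ (m : ℕ) (j : Fin s), (j : ℕ) = m → x j = 0 from funext fun j => H j j rfl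
    intro m
    induction m using Nat.strong_induction_on with
    | _ m ih =>
    intro j hj
    have h := congrFun hx j.castSucc
    simp only [vecMul, dotProduct, U, Matrix.of_apply] at h
    rw [Finset.sum_eq_single j] at h
    · simpa [ha] using h
    · intro j' _ hj'
      have h1 : j.castSucc ≠ j'.castSucc := fun h => hj' (Fin.castSucc_injective _ h).symm
      rw [if_neg h1]
      split_ifs with h2
      · have h3 := congrArg Fin.val h2
        simp only [Fin.val_castSucc, Fin.val_succ] at h3
        rw [ih j' (by omega) j' rfl, zero_mul]
      · simp
    · simp

theorem U_mulVec {s : ℕ} (a b : k) (y : Fin (s + 1) → k) (j : Fin s) :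
    (U s a b *ᵥ y) j = a * y j.castSucc + b * y j.succ := by
  have h1 : j.castSucc ≠ j.succ := (Fin.castSucc_lt_succ).ne
  have h : ∀ l : Fin (s + 1), U s a b j l * y l =
      (if l = j.castSucc then a * y l else 0) + if l = j.succ then b * y l else 0 := by
    intro l
    simp only [U, Matrix.of_apply]
    split_ifs with h2 h3
    · exact absurd (h2.symm.trans h3) h1
    all_goals simp
  simp only [mulVec, dotProduct, h, Finset.sum_add_distrib]
  simp

theorem blockDiagonal'_mulVec {ι : Type*} [Fintype ι] [DecidableEq ι] {m n : ι → Type*}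
    [∀ i, Fintype (n i)] (d : ∀ i, Matrix (m i) (n i) k) (y : (Σ i, n i) → k) (i : ι) (j : m i) :
    (blockDiagonal' d *ᵥ y) ⟨i, j⟩ = (d i *ᵥ fun l => y ⟨i, l⟩) j := by
  simp only [mulVec, dotProduct, Fintype.sum_sigma]
  rw [Finset.sum_eq_single i]
  · simp
  · intro i' _ hi'
    exact Finset.sum_eq_zero fun l _ => by rw [blockDiagonal'_apply_ne _ _ _ hi'.symm, zero_mul]
  · simp

theorem vecMul_blockDiagonal' {ι : Type*} [Fintype ι] [DecidableEq ι] {m n : ι → Type*}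
    [∀ i, Fintype (m i)] (d : ∀ i, Matrix (m i) (n i) k) (x : (Σ i, m i) → k) (i : ι) (l : n i) :
    (x ᵥ* blockDiagonal' d) ⟨i, l⟩ = ((fun j => x ⟨i, j⟩) ᵥ* d i) l := by
  rw [← mulVec_transpose, ← mulVec_transpose, blockDiagonal'_transpose, blockDiagonal'_mulVec]

variable {r h : ℕ} (p : Parts r h) (c : ℕ)

/-- The rows and columns of the padded matrix `F`, arranged by blocks: those of `0_r`, those of
`0_{r+h}`, both grouped by the parts of the partition, and the `c` zero rows and columns. -/
abbrev Index : Type := ((Σ i, Fin (p.part i)) ⊕ (Σ i, Fin (p.part i + 1))) ⊕ Fin c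

/-- The enumeration of the rows and columns used by `paddedF`. -/
def indexEquiv {n : ℕ} (hn : 2 * r + h + c = n) : Index p c ≃ Fin n :=
  ((((finSigmaFinEquiv.trans (finCongr p.sum_eq)).sumCongr
    (finSigmaFinEquiv.trans (finCongr p.sum_succ_eq))).trans
      (finSumFinEquiv.trans (finCongr (by omega)))).sumCongr (Equiv.refl (Fin c))).trans
    (finSumFinEquiv.trans (finCongr hn))

/-- The block diagonal matrix with blocks `U_{r₁}, …, U_{r_h}`, indexed by pairs. -/
def blockU (a b : k) : Matrix (Σ i, Fin (p.part i)) (Σ i, Fin (p.part i + 1)) k :=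
  blockDiagonal' fun i => U (p.part i) a b

/-- The padded matrix `F`, indexed by blocks. -/
def modelF (a b : k) : Matrix (Index p c) (Index p c) k :=
  fromBlocks (fromBlocks 0 (blockU p a b) (-(blockU p a b)ᵀ) 0) 0 0 0

theorem paddedF_eq_reindex {n : ℕ} (hn : 2 * r + h + c = n) (a b : k) :
    paddedF p c hn a b = reindex (indexEquiv p c hn) (indexEquiv p c hn) (modelF p c a b) := by
  rw [← Equiv.symm_apply_eq, reindex_symm]
  ext ((x | x) | x) ((y | y) | y) <;>
    simp [paddedF, modelF, indexEquiv, F, Fbar, blockU]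

theorem castF_eq_paddedF {n : ℕ} (hn : 2 * r + h = n) (a b : k) :
    castF p hn a b = paddedF p 0 hn a b := by
  subst hn
  ext x y
  have hx : x = finSumFinEquiv (m := 2 * r + h) (n := 0) (Sum.inl x) := rfl
  have hy : y = finSumFinEquiv (m := 2 * r + h) (n := 0) (Sum.inl y) := rfl
  rw [hx, hy]
  simp only [paddedF, castF, finCongr_refl, Equiv.trans_refl, reindex_apply, submatrix_apply,
    Equiv.symm_apply_apply, fromBlocks_apply₁₁]
  rfl

theorem blockU_linear (a b : k) :
    blockU p a b = a • blockU p (1 : k) 0 + b • blockU p 0 1 := by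
  ext ⟨i, j⟩ ⟨i', l⟩
  by_cases hi : i = i'
  · subst hi
    have h1 : j.castSucc ≠ j.succ := (Fin.castSucc_lt_succ).ne
    simp only [blockU, Matrix.add_apply, Matrix.smul_apply, blockDiagonal'_apply_eq, U,
      of_apply, smul_eq_mul]
    split_ifs with h2 h3 <;> simp
  · simp [blockU, blockDiagonal'_apply_ne _ _ _ hi]

theorem modelF_linear (a b : k) :
    modelF p c a b = a • modelF p c (1 : k) 0 + b • modelF p c 0 1 := by
  simp only [modelF, blockU_linear p a b, fromBlocks_smul, fromBlocks_add, smul_zero, add_zero,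
    transpose_add, transpose_smul, neg_add, smul_neg]

theorem paddedF_linear {n : ℕ} (hn : 2 * r + h + c = n) (a b : k) :
    paddedF p c hn a b = a • paddedF p c hn (1 : k) 0 + b • paddedF p c hn 0 1 := by
  simp only [paddedF_eq_reindex]
  rw [modelF_linear]
  rfl

theorem paddedF_transpose {n : ℕ} (hn : 2 * r + h + c = n) (a b : k) :
    (paddedF p c hn a b)ᵀ = -paddedF p c hn a b := by
  simp only [paddedF_eq_reindex, transpose_reindex]
  have : (modelF p c a b)ᵀ = -modelF p c a b := by
    simp [modelF, fromBlocks_transpose, fromBlocks_neg]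
  rw [this]
  rfl

end Model

section ModelField

variable {k : Type*} [Field k] {r h : ℕ} (p : Parts r h) (c : ℕ)

theorem vecMul_blockU_injective {a b : k} (hab : ¬(a = 0 ∧ b = 0))
    {x : (Σ i, Fin (p.part i)) → k} (hx : x ᵥ* blockU p a b = 0) : x = 0 := by
  have h : ∀ i, (fun j => x ⟨i, j⟩) = 0 := fun i => vecMul_U_injective hab (by
    ext l
    rw [← vecMul_blockDiagonal' (fun i => U (p.part i) a b) x i l]
    exact congrFun hx ⟨i, l⟩)
  ext ⟨i, j⟩
  exact congrFun (h i) j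

theorem rank_blockU {a b : k} (hab : ¬(a = 0 ∧ b = 0)) : (blockU p a b).rank = r := by
  rw [LinearIndependent.rank_matrix]
  · simp [p.sum_eq]
  · rw [← vecMul_injective_iff]
    intro x y hxy
    have h1 : (x - y) ᵥ* blockU p a b = 0 := by
      rw [sub_vecMul]
      exact sub_eq_zero.2 hxy
    exact sub_eq_zero.1 (vecMul_blockU_injective p hab h1)

theorem rank_paddedF {n : ℕ} (hn : 2 * r + h + c = n) {a b : k} (hab : ¬(a = 0 ∧ b = 0)) :
    (paddedF p c hn a b).rank = 2 * r := by
  rw [paddedF_eq_reindex, rank_reindex, modelF, rank_fromBlocks_diag, rank_fromBlocks_antidiag,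
    rank_neg_eq, rank_transpose, rank_blockU p hab, Matrix.rank_zero]
  omega

theorem mem_spaceOf_paddedF {n : ℕ} (hn : 2 * r + h + c = n) {A : Matrix (Fin n) (Fin n) k} :
    A ∈ spaceOf (paddedF p c hn) ↔ ∃ a b : k, paddedF p c hn a b = A := by
  constructor
  · intro hA
    refine Submodule.span_induction ?_ ⟨0, 0, ?_⟩ ?_ ?_ hA
    · rintro _ ⟨⟨a, b⟩, rfl⟩
      exact ⟨a, b, rfl⟩
    · rw [paddedF_linear]
      simp
    · rintro _ _ _ _ ⟨a, b, rfl⟩ ⟨a', b', rfl⟩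
      refine ⟨a + a', b + b', ?_⟩
      rw [paddedF_linear p c hn a b, paddedF_linear p c hn a' b', paddedF_linear]
      module
    · rintro t _ _ ⟨a, b, rfl⟩
      refine ⟨t * a, t * b, ?_⟩
      rw [paddedF_linear p c hn a b, paddedF_linear]
      module
  · rintro ⟨a, b, rfl⟩
    exact Submodule.subset_span ⟨(a, b), rfl⟩

theorem isConstRankPencil_spaceOf_paddedF (hr : 1 ≤ r) {n : ℕ} (hn : 2 * r + h + c = n) :
    IsConstRankPencil (spaceOf (paddedF p c hn : k → k → Matrix (Fin n) (Fin n) k)) (2 * r) where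
  skew A hA := by
    obtain ⟨a, b, rfl⟩ := (mem_spaceOf_paddedF p c hn).1 hA
    exact paddedF_transpose p c hn a b
  finrank_eq := by
    have hli : LinearIndependent k ![paddedF p c hn (1 : k) 0, paddedF p c hn 0 1] := by
      rw [LinearIndependent.pair_iff]
      intro a b hab
      by_contra hne
      rw [← paddedF_linear] at hab
      have := rank_paddedF p c hn hne
      rw [hab, Matrix.rank_zero] at this
      omega
    have hspan : spaceOf (paddedF p c hn : k → k → Matrix (Fin n) (Fin n) k) =
        Submodule.span k (Set.range ![paddedF p c hn (1 : k) 0, paddedF p c hn 0 1]) := by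
      ext A
      rw [mem_spaceOf_paddedF, Matrix.range_cons, Matrix.range_cons, Matrix.range_empty,
        Set.union_empty, Set.singleton_union, Submodule.mem_span_pair]
      simp only [← paddedF_linear]
    rw [hspan, finrank_span_eq_card hli, Fintype.card_fin]
  rank_eq A hA hA0 := by
    obtain ⟨a, b, rfl⟩ := (mem_spaceOf_paddedF p c hn).1 hA
    refine rank_paddedF p c hn ?_
    rintro ⟨rfl, rfl⟩
    rw [paddedF_linear] at hA0
    simp at hA0

/-- The matrices `F` without padding have no common kernel. -/
theorem eq_zero_of_paddedF_mulVec {n : ℕ} (hn : 2 * r + h + 0 = n) {x : Fin n → k}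
    (hx : ∀ a b : k, paddedF p 0 hn a b *ᵥ x = 0) : x = 0 := by
  let y := x ∘ indexEquiv p 0 hn
  have hy : ∀ a b : k, modelF p 0 a b *ᵥ y = 0 := by
    intro a b
    have h1 := hx a b
    rw [paddedF_eq_reindex, reindex_apply, submatrix_mulVec_equiv] at h1
    ext i
    have h2 := congrFun h1 (indexEquiv p 0 hn i)
    simpa [y] using h2
  have h1 : ∀ a b : k, blockU p a b *ᵥ (y ∘ Sum.inl ∘ Sum.inr) = 0 := by
    intro a b
    ext i
    have := congrFun (hy a b) (Sum.inl (Sum.inl i))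
    simpa [modelF, fromBlocks_mulVec, Function.comp_assoc] using this
  have h2 : (y ∘ Sum.inl ∘ Sum.inl) ᵥ* blockU p (1 : k) 0 = 0 := by
    ext i
    have := congrFun (hy 1 0) (Sum.inl (Sum.inr i))
    simpa [modelF, fromBlocks_mulVec, Function.comp_assoc, neg_mulVec, mulVec_transpose] using this
  have h3 := vecMul_blockU_injective p (by simp) h2
  have h4 : y ∘ Sum.inl ∘ Sum.inr = 0 := by
    ext ⟨i, l⟩
    have hU := fun (a b : k) (j : Fin (p.part i)) => congrFun (h1 a b) ⟨i, j⟩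
    simp only [blockU, blockDiagonal'_mulVec, U_mulVec, Pi.zero_apply] at hU
    induction l using Fin.lastCases with
    | cast j => simpa using hU 1 0 j
    | last =>
      have hp := p.pos i
      have := hU 0 1 ⟨p.part i - 1, by omega⟩
      have hl : Fin.last (p.part i) = Fin.succ ⟨p.part i - 1, by omega⟩ := by
        ext; simp; omega
      rw [hl]
      simpa using this
  ext i
  obtain ⟨j, rfl⟩ := (indexEquiv p 0 hn).surjective i
  rcases j with (j | j) | j
  · exact congrFun h3 j
  · exact congrFun h4 j
  · exact j.elim0

/-- The basis vector of an index of the padding lies in all kernels. -/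
theorem exists_ne_zero_paddedF_mulVec (hc : c ≠ 0) {n : ℕ} (hn : 2 * r + h + c = n) :
    ∃ x : Fin n → k, x ≠ 0 ∧ ∀ a b : k, paddedF p c hn a b *ᵥ x = 0 := by
  let z : Fin n := indexEquiv p c hn (Sum.inr ⟨0, Nat.pos_of_ne_zero hc⟩)
  refine ⟨Pi.single z 1, by simp, fun a b => ?_⟩
  rw [mulVec_single_one]
  ext i
  obtain ⟨j, rfl⟩ := (indexEquiv p c hn).surjective i
  rw [paddedF_eq_reindex]
  rcases j with j | j <;> simp [z, modelF, Matrix.col]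

end ModelField

section Congruence

variable {k : Type*} [Field k] {n : ℕ}

theorem congruence_apply (g A : Matrix (Fin n) (Fin n) k) : congruence g A = g * A * gᵀ := rfl

theorem congruence_injective (g : SpecialLinearGroup (Fin n) k) :
    Function.Injective (congruence (g : Matrix (Fin n) (Fin n) k)) := by
  have hg : IsUnit (g : Matrix (Fin n) (Fin n) k) := by
    rw [isUnit_iff_isUnit_det, g.det_coe]; exact isUnit_one
  have hg' : IsUnit (g : Matrix (Fin n) (Fin n) k)ᵀ := by
    rw [isUnit_iff_isUnit_det, det_transpose, g.det_coe]; exact isUnit_one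
  intro A B hAB
  exact hg.mul_left_cancel (hg'.mul_right_cancel hAB)

theorem IsConstRankPencil.of_map_congruence (g : SpecialLinearGroup (Fin n) k)
    {M : Submodule k (Matrix (Fin n) (Fin n) k)} {s : ℕ}
    (h : IsConstRankPencil (M.map (congruence (g : Matrix (Fin n) (Fin n) k))) s) :
    IsConstRankPencil M s where
  skew A hA := by
    apply congruence_injective g
    have := h.skew _ (Submodule.mem_map_of_mem hA)
    rw [map_neg, ← this]
    simp [congruence_apply, Matrix.mul_assoc]
  finrank_eq := by
    rw [← h.finrank_eq]
    exact (Submodule.equivMapOfInjective _ (congruence_injective g) M).finrank_eq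
  rank_eq A hA hA0 := by
    rw [← h.rank_eq _ (Submodule.mem_map_of_mem hA)
      ((map_ne_zero_iff _ (congruence_injective g)).2 hA0), congruence_apply,
      rank_mul_eq_left_of_isUnit_det, rank_mul_eq_right_of_isUnit_det]
    · simp
    · simp

/-- For spaces of skew-symmetric matrices the condition on the images follows from the condition
on the kernels. -/
theorem nondegenerate_iff {M : Submodule k (Matrix (Fin n) (Fin n) k)}
    (hM : ∀ A ∈ M, Aᵀ = -A) :
    Nondegenerate M ↔ ∀ x : Fin n → k, (∀ A ∈ M, A *ᵥ x = 0) → x = 0 := by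
  constructor
  · intro h x hx
    have : x ∈ ⨅ A ∈ M, LinearMap.ker (Matrix.mulVecLin A) := by
      simpa [Submodule.mem_iInf] using hx
    rwa [h.1, Submodule.mem_bot] at this
  · intro h
    refine ⟨?_, ?_⟩
    · rw [eq_bot_iff]
      intro x hx
      exact h x (by simpa [Submodule.mem_iInf] using hx)
    · by_contra hne
      obtain ⟨f, hf0, hf⟩ := Submodule.exists_le_ker_of_lt_top _ (lt_top_iff_ne_top.2 hne)
      obtain ⟨x, rfl⟩ := (dotProductEquiv k (Fin n)).surjective f
      have hx0 : x ≠ 0 := by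
        rintro rfl
        exact hf0 (map_zero _)
      refine hx0 (h x fun A hA => ?_)
      have h1 : x ᵥ* A = 0 := by
        apply dotProduct_eq_zero
        intro y
        rw [← dotProduct_mulVec]
        have : A *ᵥ y ∈ ⨆ A ∈ M, LinearMap.range (Matrix.mulVecLin A) :=
          Submodule.mem_iSup_of_mem A (Submodule.mem_iSup_of_mem hA ⟨y, rfl⟩)
        exact hf this
      rw [← vecMul_transpose, hM A hA, vecMul_neg, h1, neg_zero]

theorem nondegenerate_iff_of_map_congruence {r h c : ℕ} (p : Parts r h) (hn : 2 * r + h + c = n)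
    (g : SpecialLinearGroup (Fin n) k) {M : Submodule k (Matrix (Fin n) (Fin n) k)}
    (hM : ∀ A ∈ M, Aᵀ = -A)
    (hg : M.map (congruence (g : Matrix (Fin n) (Fin n) k)) = spaceOf (paddedF p c hn)) :
    Nondegenerate M ↔ c = 0 := by
  rw [nondegenerate_iff hM]
  have hgu : IsUnit (g : Matrix (Fin n) (Fin n) k) := by
    rw [isUnit_iff_isUnit_det, g.det_coe]; exact isUnit_one
  have hgu' : IsUnit (g : Matrix (Fin n) (Fin n) k)ᵀ := by
    rw [isUnit_iff_isUnit_det, det_transpose, g.det_coe]; exact isUnit_one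
  constructor
  · intro h
    by_contra hc
    obtain ⟨x, hx0, hx⟩ := exists_ne_zero_paddedF_mulVec (k := k) p c hc hn
    apply hx0
    apply mulVec_injective_of_isUnit hgu'
    simp only [mulVec_zero]
    refine h _ fun A hA => ?_
    apply mulVec_injective_of_isUnit hgu
    obtain ⟨a, b, hab⟩ := (mem_spaceOf_paddedF p c hn).1 (hg ▸ Submodule.mem_map_of_mem hA)
    rw [mulVec_mulVec, mulVec_mulVec, mulVec_zero, ← hx a b, hab, congruence_apply]
  · rintro rfl x hx
    obtain ⟨y, rfl⟩ := mulVec_surjective_iff_isUnit.2 hgu' x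
    have hy : y = 0 := by
      refine eq_zero_of_paddedF_mulVec p hn fun a b => ?_
      have hmem : paddedF p 0 hn a b ∈ M.map (congruence (g : Matrix (Fin n) (Fin n) k)) :=
        hg ▸ (mem_spaceOf_paddedF p 0 hn).2 ⟨a, b, rfl⟩
      obtain ⟨A, hA, hAF⟩ := hmem
      have h1 := hx A hA
      rw [← hAF, congruence_apply, ← mulVec_mulVec, ← mulVec_mulVec, h1, mulVec_zero]
    rw [hy, mulVec_zero]

end Congruence

/-! ### Congruence to the matrices `F` -/

section NormalForm

/-- A finite family of natural numbers with `c` zeros, arranged in order: a partition followed by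
zeros. -/
theorem exists_parts {ι : Type*} [Fintype ι] (r : ι → ℕ) :
    ∃ (h c : ℕ) (p : Parts (∑ i, r i) h) (σ : Fin h ⊕ Fin c ≃ ι),
      (∀ i, r (σ (Sum.inl i)) = p.part i) ∧ ∀ i, r (σ (Sum.inr i)) = 0 := by
  classical
  let e₀ : Fin (Fintype.card {i // 0 < r i}) ≃ {i // 0 < r i} := (Fintype.equivFin _).symm
  let s := Tuple.sort fun i => OrderDual.toDual (r (e₀ i))
  have hs : Antitone fun i => r (e₀ (s i)) := fun i j hij =>
    Tuple.monotone_sort (fun i => OrderDual.toDual (r (e₀ i))) hij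
  let σ := ((s.trans e₀).sumCongr (Fintype.equivFin {i // ¬0 < r i}).symm).trans
    (Equiv.sumCompl fun i => 0 < r i)
  have hinl : ∀ i, σ (Sum.inl i) = e₀ (s i) := fun i => rfl
  have hinr : ∀ i, r (σ (Sum.inr i)) = 0 := fun i =>
    Nat.eq_zero_of_not_pos ((Fintype.equivFin {i // ¬0 < r i}).symm i).2
  refine ⟨_, _, ⟨fun i => r (e₀ (s i)), fun i => (e₀ (s i)).2, hs, ?_⟩, σ, fun i => rfl, hinr⟩
  rw [← σ.sum_comp, Fintype.sum_sum_type]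
  simp [hinl, hinr]

variable {k : Type u} [Field k] {n : ℕ}

/-- The bilinear form `(v, w) ↦ vᵗ A w` of a square matrix. -/
def formOf (A : Matrix (Fin n) (Fin n) k) : (Fin n → k) →ₗ[k] (Fin n → k) →ₗ[k] k :=
  toLinearMap₂' k A

theorem formOf_apply (A : Matrix (Fin n) (Fin n) k) (v w : Fin n → k) :
    formOf A v w = v ⬝ᵥ A *ᵥ w :=
  toLinearMap₂'_apply' A v w

theorem formOf_pencil (A B : Matrix (Fin n) (Fin n) k) (a b : k) :
    formOf (a • A + b • B) = a • formOf A + b • formOf B := by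
  simp [formOf]

theorem isAlt_formOf [CharZero k] {A : Matrix (Fin n) (Fin n) k} (hA : Aᵀ = -A) :
    (formOf A).IsAlt := by
  intro v
  rw [formOf_apply]
  have h : v ⬝ᵥ A *ᵥ v = -(v ⬝ᵥ A *ᵥ v) := by
    conv_lhs => rw [dotProduct_mulVec, ← mulVec_transpose, hA, dotProduct_comm, neg_mulVec,
      dotProduct_neg]
  exact self_eq_neg.1 h

theorem finrank_ker_formOf (A : Matrix (Fin n) (Fin n) k) :
    A.rank + finrank k (LinearMap.ker (formOf A)) = n := by
  have h : LinearMap.ker (formOf A) = LinearMap.ker Aᵀ.mulVecLin := by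
    ext v
    rw [LinearMap.mem_ker, LinearMap.mem_ker, mulVecLin_apply, mulVec_transpose]
    constructor
    · intro hv
      refine dotProduct_eq_zero _ fun w => ?_
      rw [← dotProduct_mulVec, ← formOf_apply, hv, LinearMap.zero_apply]
    · intro hv
      refine LinearMap.ext fun w => ?_
      rw [formOf_apply, dotProduct_mulVec, hv, zero_dotProduct, LinearMap.zero_apply]
  rw [h, ← rank_transpose A, Matrix.rank, LinearMap.finrank_range_add_finrank_ker]
  simp

/-- The scaling of the basis vectors by `t`, `t⁻¹` and `1` on the three groups of indices; the
congruence by this diagonal matrix fixes the pencil `F`. -/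
def scaling {r h : ℕ} (p : Parts r h) (c : ℕ) (t : k) : Index p c → k :=
  Sum.elim (Sum.elim (fun _ => t) fun _ => t⁻¹) fun _ => 1

theorem prod_scaling {r h : ℕ} (p : Parts r h) (c : ℕ) {t : k} (ht : t ≠ 0) :
    ∏ i, scaling p c t i = (t ^ h)⁻¹ := by
  simp only [scaling, Fintype.prod_sum_type, Sum.elim_inl, Sum.elim_inr, Finset.prod_const,
    Finset.card_univ, Fintype.card_sigma, Fintype.card_fin, p.sum_eq, p.sum_succ_eq, one_pow,
    mul_one, pow_add, inv_pow]
  field_simp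

theorem scaling_mul_modelF {r h : ℕ} (p : Parts r h) (c : ℕ) {t : k} (ht : t ≠ 0) (a b : k)
    (i j : Index p c) : scaling p c t i * modelF p c a b i j * scaling p c t j =
      modelF p c a b i j := by
  rcases i with (i | i) | i <;> rcases j with (j | j) | j <;> simp [scaling, modelF] <;> field_simp

/-- A skew-symmetric pencil of constant rank has the matrix `F`, with padding, in some basis. -/
theorem exists_gram_eq_modelF [IsAlgClosed k] [CharZero k] {A B : Matrix (Fin n) (Fin n) k}
    (hA : Aᵀ = -A) (hB : Bᵀ = -B) {r : ℕ}
    (hrank : ∀ a b : k, ¬(a = 0 ∧ b = 0) → (a • A + b • B).rank = 2 * r) :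
    ∃ (h c : ℕ) (p : Parts r h) (v : Index p c → Fin n → k), 2 * r + h + c = n ∧
      Submodule.span k (Set.range v) = ⊤ ∧
      ∀ i j, v i ⬝ᵥ A *ᵥ v j = modelF p c 1 0 i j ∧ v i ⬝ᵥ B *ᵥ v j = modelF p c 0 1 i j := by
  have hd : HasConstCorank (formOf A) (formOf B) (n - 2 * r) := by
    intro a b hab
    have h1 := finrank_ker_formOf (a • A + b • B)
    rw [hrank a b hab] at h1
    rw [← formOf_pencil]
    omega
  have hAalt := isAlt_formOf hA
  have hBalt := isAlt_formOf hB
  obtain ⟨ι, _, ρ, w, e, hwe, hcard, hsum⟩ := exists_isSkewKroneckerFamily hAalt hBalt hd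
  rw [finrank_fin_fun] at hsum
  have hle : 2 * r ≤ n := by
    rw [← hrank 1 0 (by simp)]
    simpa using rank_le_width (((1 : k) • A + (0 : k) • B))
  obtain rfl : ∑ i, ρ i = r := by omega
  obtain ⟨h, c, p, σ, hpos, hzero⟩ := exists_parts ρ
  have hhc : h + c = n - 2 * ∑ i, ρ i := by
    rw [← hcard, ← Fintype.card_congr σ]
    simp
  let v : Index p c → Fin n → k := Sum.elim (Sum.elim (fun x => w (σ (Sum.inl x.1)) x.2)
    fun x => e (σ (Sum.inl x.1)) x.2) fun i => e (σ (Sum.inr i)) 0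
  refine ⟨h, c, p, v, by omega, ?_, ?_⟩
  · rw [eq_top_iff, ← hwe.span_eq]
    apply Submodule.span_mono
    rintro _ (⟨i, j, hj, rfl⟩ | ⟨i, j, hj, rfl⟩)
    · obtain ⟨i | i, rfl⟩ := σ.surjective i
      · exact ⟨Sum.inl (Sum.inl ⟨i, ⟨j, by rwa [← hpos]⟩⟩), rfl⟩
      · rw [hzero] at hj
        omega
    · obtain ⟨i | i, rfl⟩ := σ.surjective i
      · exact ⟨Sum.inl (Sum.inr ⟨i, ⟨j, by rw [← hpos]; omega⟩⟩), rfl⟩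
      · obtain rfl : j = 0 := by
          rw [hzero] at hj
          omega
        exact ⟨Sum.inr i, rfl⟩
  · simp only [← formOf_apply]
    have hUU : ∀ (x : Σ i, Fin (p.part i)) (y : Σ i, Fin (p.part i + 1)),
        formOf A (w (σ (Sum.inl x.1)) x.2) (e (σ (Sum.inl y.1)) y.2) =
          blockU p 1 0 x y ∧
        formOf B (w (σ (Sum.inl x.1)) x.2) (e (σ (Sum.inl y.1)) y.2) =
          blockU p 0 1 x y := by
      rintro ⟨i, j⟩ ⟨i', l⟩
      by_cases hi : i = i'
      · subst hi
        have := hwe.self (σ (Sum.inl i)) j l (by rw [hpos]; omega) (by rw [hpos]; omega)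
        rw [this.1, this.2]
        have h1 : j.castSucc ≠ j.succ := (Fin.castSucc_lt_succ).ne
        simp only [blockU, blockDiagonal'_apply_eq, U, of_apply, Fin.ext_iff, Fin.val_castSucc,
          Fin.val_succ]
        refine ⟨by split_ifs <;> rfl, ?_⟩
        split_ifs <;> first | rfl | omega
      · have := hwe.of_ne (σ (Sum.inl i)) (σ (Sum.inl i')) j l (by simpa using hi)
          (by rw [hpos]; omega) (by rw [hpos]; omega)
        simp [this.1, this.2, blockU, blockDiagonal'_apply_ne _ _ _ hi]
    have hU0 : ∀ (x : Σ i, Fin (p.part i)) (y : Fin c),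
        formOf A (w (σ (Sum.inl x.1)) x.2) (e (σ (Sum.inr y)) 0) = 0 ∧
        formOf B (w (σ (Sum.inl x.1)) x.2) (e (σ (Sum.inr y)) 0) = 0 := fun x y =>
      hwe.of_ne _ _ _ _ (by simp) (by rw [hpos]; omega) (Nat.zero_le _)
    rintro ((x | x) | x) ((y | y) | y)
    · exact hwe.left_left _ _ _ _
    · exact hUU x y
    · exact hU0 x y
    · simp only [v, Sum.elim_inl, Sum.elim_inr, modelF, fromBlocks_apply₁₁, fromBlocks_apply₂₁,
        Matrix.neg_apply, transpose_apply]
      rw [← hAalt.neg, ← hBalt.neg, (hUU y x).1, (hUU y x).2]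
      exact ⟨rfl, rfl⟩
    · exact hwe.right_right _ _ _ _
    · exact hwe.right_right _ _ _ _
    · simp only [v, Sum.elim_inl, Sum.elim_inr, modelF, fromBlocks_apply₂₁, Matrix.zero_apply]
      rw [← hAalt.neg, ← hBalt.neg, (hU0 y x).1, (hU0 y x).2]
      simp
    · exact hwe.right_right _ _ _ _
    · exact hwe.right_right _ _ _ _

/-- A skew-symmetric pencil of constant rank is congruent to a padded matrix `F` under the special
linear group. The congruence found first need not have determinant one, but `F` is fixed by the
congruences `diag(t, t⁻¹, 1)` of determinant `t⁻ʰ`. -/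
theorem exists_congruence_eq_paddedF [IsAlgClosed k] [CharZero k] {A B : Matrix (Fin n) (Fin n) k}
    (hA : Aᵀ = -A) (hB : Bᵀ = -B) {r : ℕ} (hr : 1 ≤ r)
    (hrank : ∀ a b : k, ¬(a = 0 ∧ b = 0) → (a • A + b • B).rank = 2 * r) :
    ∃ (h c : ℕ) (p : Parts r h) (hn : 2 * r + h + c = n) (g : SpecialLinearGroup (Fin n) k),
      ∀ a b : k, congruence (g : Matrix (Fin n) (Fin n) k) (a • A + b • B) = paddedF p c hn a b := by
  obtain ⟨h, c, p, v, hn, hspan, hv⟩ := exists_gram_eq_modelF hA hB hrank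
  let σ := indexEquiv p c hn
  let G : Matrix (Fin n) (Fin n) k := Matrix.of fun i => v (σ.symm i)
  have hG : G.det ≠ 0 := by
    have hli : LinearIndependent k G.row := by
      refine linearIndependent_of_top_le_span_of_card_eq_finrank ?_ (by simp)
      have : Set.range G.row = Set.range v := σ.symm.surjective.range_comp v
      rw [this, hspan]
    exact ((isUnit_iff_isUnit_det _).1 (linearIndependent_rows_iff_isUnit.1 hli)).ne_zero
  have hh : 0 < h := by
    rcases Nat.eq_zero_or_pos h with rfl | hh
    · have := p.sum_eq
      simp at this
      omega
    · exact hh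
  -- the determinant of the scaling is `t⁻ʰ`, so a suitable `t` normalizes the determinant to one
  obtain ⟨t, ht⟩ := IsAlgClosed.exists_pow_nat_eq G.det hh
  have ht0 : t ≠ 0 := by
    rintro rfl
    rw [zero_pow hh.ne'] at ht
    exact hG ht.symm
  let D : Matrix (Fin n) (Fin n) k := diagonal fun i => scaling p c t (σ.symm i)
  have hdet : (D * G).det = 1 := by
    rw [det_mul, det_diagonal, σ.symm.prod_comp (scaling p c t), prod_scaling p c ht0, ht,
      inv_mul_cancel₀ hG]
  refine ⟨h, c, p, hn, ⟨D * G, hdet⟩, fun a b => ?_⟩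
  have hgram : G * (a • A + b • B) * Gᵀ = paddedF p c hn a b := by
    ext i j
    have h1 : ∀ C : Matrix (Fin n) (Fin n) k, (G * C * Gᵀ) i j =
        v (σ.symm i) ⬝ᵥ C *ᵥ v (σ.symm j) := by
      intro C
      rw [Matrix.mul_assoc]
      rfl
    rw [h1, add_mulVec, dotProduct_add, smul_mulVec, smul_mulVec, dotProduct_smul,
      dotProduct_smul, (hv _ _).1, (hv _ _).2, paddedF_eq_reindex, modelF_linear p c a b]
    rfl
  rw [congruence_apply]
  change D * G * (a • A + b • B) * (D * G)ᵀ = _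
  rw [transpose_mul, ← Matrix.mul_assoc, Matrix.mul_assoc D G, Matrix.mul_assoc D, hgram,
    diagonal_transpose, paddedF_eq_reindex]
  ext i j
  rw [mul_diagonal, diagonal_mul]
  exact scaling_mul_modelF p c ht0 a b _ _

/-- The spaces of constant rank, with a basis `A, B` given: one congruence takes `aA + bB` to a padded
matrix `F` and the space to the space of that matrix. -/
theorem exists_congruence_of_span_pair [IsAlgClosed k] [CharZero k]
    {M : Submodule k (Matrix (Fin n) (Fin n) k)} {r : ℕ} (hr : 1 ≤ r)
    (hM : IsConstRankPencil M (2 * r)) {A B : Matrix (Fin n) (Fin n) k}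
    (hAB : Submodule.span k {A, B} = M) :
    ∃ (h c : ℕ) (p : Parts r h) (hn : 2 * r + h + c = n) (g : SpecialLinearGroup (Fin n) k),
      (∀ a b : k, congruence (g : Matrix (Fin n) (Fin n) k) (a • A + b • B) =
        paddedF p c hn a b) ∧
      M.map (congruence (g : Matrix (Fin n) (Fin n) k)) = spaceOf (paddedF p c hn) := by
  have hmem : ∀ a b : k, a • A + b • B ∈ M := fun a b =>
    hAB ▸ Submodule.mem_span_pair.2 ⟨a, b, rfl⟩
  have hAM : A ∈ M := hAB ▸ Submodule.subset_span (by simp)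
  have hBM : B ∈ M := hAB ▸ Submodule.subset_span (by simp)
  have hli : LinearIndependent k ![A, B] := by
    rw [linearIndependent_iff_card_eq_finrank_span, Set.finrank, Matrix.range_cons,
      Matrix.range_cons, Matrix.range_empty, Set.union_empty, Set.singleton_union, hAB,
      hM.finrank_eq, Fintype.card_fin]
  obtain ⟨h, c, p, hn, g, hg⟩ := exists_congruence_eq_paddedF (hM.skew A hAM) (hM.skew B hBM) hr
    fun a b hab => hM.rank_eq _ (hmem a b) fun h0 => hab (LinearIndependent.pair_iff.1 hli a b h0)
  refine ⟨h, c, p, hn, g, hg, ?_⟩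
  ext X
  rw [Submodule.mem_map, mem_spaceOf_paddedF]
  constructor
  · rintro ⟨Y, hY, rfl⟩
    obtain ⟨a, b, rfl⟩ := Submodule.mem_span_pair.1 (hAB ▸ hY)
    exact ⟨a, b, (hg a b).symm⟩
  · rintro ⟨a, b, rfl⟩
    exact ⟨_, hmem a b, hg a b⟩

theorem IsConstRankPencil.exists_span_pair {M : Submodule k (Matrix (Fin n) (Fin n) k)} {s : ℕ}
    (hM : IsConstRankPencil M s) : ∃ A B, Submodule.span k {A, B} = M := by
  let b := finBasisOfFinrankEq k M hM.finrank_eq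
  refine ⟨b 0, b 1, ?_⟩
  have h := congrArg (Submodule.map M.subtype) b.span_eq
  rw [Submodule.map_span, Submodule.map_top, Submodule.range_subtype, ← Set.range_comp] at h
  refine Eq.trans ?_ h
  congr 1
  ext X
  simp [Fin.exists_fin_two, eq_comm]

end NormalForm

end SkewPencil

/-! ### The classification -/

theorem mainTheorem1 {k : Type*} [Field k] [IsAlgClosed k] [CharZero k] (N r : ℕ) (hr : 1 ≤ r) :
    -- the orbits of nondegenerate spaces
    (∀ M : Submodule k (Matrix (Fin (N + 1)) (Fin (N + 1)) k),
      (SkewPencil.IsConstRankPencil M (2 * r) ∧ SkewPencil.Nondegenerate M) ↔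
        ∃ (h : ℕ) (p : SkewPencil.Parts r h) (hN : 2 * r + h = N + 1),
          SkewPencil.SLEquivalent M (SkewPencil.spaceOf (SkewPencil.castF p hN))) ∧
    -- the same for the pencil `aA + bB` attached to any basis of such a space
    (∀ (M : Submodule k (Matrix (Fin (N + 1)) (Fin (N + 1)) k)),
      SkewPencil.IsConstRankPencil M (2 * r) → SkewPencil.Nondegenerate M →
      ∀ A B : Matrix (Fin (N + 1)) (Fin (N + 1)) k, Submodule.span k {A, B} = M →
        ∃ (h : ℕ) (p : SkewPencil.Parts r h) (hN : 2 * r + h = N + 1),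
          SkewPencil.SLCongruentPencils A B
            (SkewPencil.castF p hN 1 0) (SkewPencil.castF p hN 0 1) ∧
          SkewPencil.StrictlyEquivalent A B
            (SkewPencil.castF p hN 1 0) (SkewPencil.castF p hN 0 1)) ∧
    -- the orbits of all spaces
    (∀ M : Submodule k (Matrix (Fin (N + 1)) (Fin (N + 1)) k),
      SkewPencil.IsConstRankPencil M (2 * r) ↔
        ∃ (h c : ℕ) (p : SkewPencil.Parts r h) (hN : 2 * r + h + c = N + 1),
          SkewPencil.SLEquivalent M (SkewPencil.spaceOf (SkewPencil.paddedF p c hN))) := by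
  have hcast : ∀ {h : ℕ} (p : SkewPencil.Parts r h) (hN : 2 * r + h = N + 1),
      (SkewPencil.castF p hN : k → k → _) = SkewPencil.paddedF p 0 hN := fun p hN =>
    funext fun a => funext fun b => SkewPencil.castF_eq_paddedF p hN a b
  refine ⟨fun M => ⟨?_, ?_⟩, fun M hM hnd A B hAB => ?_, fun M => ⟨fun hM => ?_, ?_⟩⟩
  · rintro ⟨hM, hnd⟩
    obtain ⟨A, B, hAB⟩ := hM.exists_span_pair
    obtain ⟨h, c, p, hn, g, -, hg⟩ := SkewPencil.exists_congruence_of_span_pair hr hM hAB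
    obtain rfl := (SkewPencil.nondegenerate_iff_of_map_congruence p hn g hM.skew hg).1 hnd
    exact ⟨h, p, hn, g, by rw [hcast, hg]⟩
  · rintro ⟨h, p, hN, g, hg⟩
    rw [hcast] at hg
    have hM : SkewPencil.IsConstRankPencil M (2 * r) := .of_map_congruence g
      (hg ▸ SkewPencil.isConstRankPencil_spaceOf_paddedF p 0 hr hN)
    exact ⟨hM, (SkewPencil.nondegenerate_iff_of_map_congruence p hN g hM.skew hg).2 rfl⟩
  · obtain ⟨h, c, p, hn, g, hgAB, hg⟩ := SkewPencil.exists_congruence_of_span_pair hr hM hAB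
    obtain rfl := (SkewPencil.nondegenerate_iff_of_map_congruence p hn g hM.skew hg).1 hnd
    have hF : ∀ a b : k, SkewPencil.congruence (g : Matrix (Fin (N + 1)) (Fin (N + 1)) k)
        (a • A + b • B) = a • SkewPencil.castF p hn 1 0 + b • SkewPencil.castF p hn 0 1 := by
      intro a b
      rw [hgAB, hcast, SkewPencil.paddedF_linear]
    refine ⟨h, p, hn, ⟨g, hF⟩, Matrix.SpecialLinearGroup.toGL g,
      Matrix.SpecialLinearGroup.toGL g.transpose, hF⟩
  · obtain ⟨A, B, hAB⟩ := hM.exists_span_pair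
    obtain ⟨h, c, p, hn, g, -, hg⟩ := SkewPencil.exists_congruence_of_span_pair hr hM hAB
    exact ⟨h, c, p, hn, g, hg⟩
  · rintro ⟨h, c, p, hN, g, hg⟩
    exact .of_map_congruence g (hg ▸ SkewPencil.isConstRankPencil_spaceOf_paddedF p c hr hN)
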